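/- Let $n \ge 3$ and let $T$ be a triangulation of a convex $n$-gon whose vertices are labelled cyclically $1,\dots,n$ (a maximal set of pairwise non-crossing diagonals); all vertex labels are read modulo $n$. Let $a_k$ be the number of triangles of $T$ incident with vertex $k$. Let $G$ be the bipartite graph whose black vertices are the $n$ vertices of $T$, whose white vertices are the triangles of $T$, and in which $v$ and $w$ are adjacent exactly when $v$ is a vertex of the triangle $w$. For $i \ne j$ let $m_{i,j}$ be the number of perfect matchings of the graph obtained from $G$ by deleting the black vertices $i$ and $j$ and all edges incident with them. Define rational numbers $f_r(i)$ for $1 \le r \le n-1$ and $i \in \mathbb{Z}$ (the Conway–Coxeter array of $T$) by $f_1(i) = 1$, $f_2(i) = a_{i+1}$, and the frieze recurrence $$f_{r+1}(i) = \frac{f_r(i)\, f_r(i+1) - 1}{f_{r-1}(i+1)} \qquad (2 \le r \le n-2),$$ where $f_r(i)$ is the entry of the $r$-th row at horizontal position $i + r/2$. Then: 1. The recurrence never divides by zero: $f_r(i) \ne 0$ for $1 \le r \le n-3$ and all $i$. 2. The array is a frieze pattern: every row has period $n$, the first row and the $(n-1)$-st row consist of $1$'s, and $f_{r-1}(i+1)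 f_{r+1}(i) = f_r(i) f_r(i+1) - 1$ for $2 \le r \le n-2$ and all $i$. 3. The frieze pattern is the array of the numbers $m_{i,j}$: $f_r(i) = m_{i,\,i+r}$ for all $1 \le r \le n-1$ and $i \in \mathbb{Z}$. 4. $m_{i,j} > 0$ for all $i \ne j$; so all entries of the pattern are positive integers. 5. Glide-reflection symmetry: $f_{n-r}(i+r) = f_r(i)$ for all $1 \le r \le n-1$ and $i \in \mathbb{Z}$, that is, row $n-r$ is row $r$ shifted by $n/2$ positions. -/

import Mathlib

/-- The vertices of the `n`-gon are labelled cyclically by `ZMod n`. `InOpenArc a b x` says that,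
going around the polygon in the direction of increasing labels, one meets `x` strictly after `a`
and strictly before `b`. -/
def InOpenArc {n : ℕ} (a b x : ZMod n) : Prop :=
  0 < (x - a).val ∧ (x - a).val < (b - a).val

/-- The chords `ab` and `cd` of the `n`-gon cross, with `c` on the arc from `a` to `b` and `d` on
the arc from `b` to `a`. -/
def ChordsCross {n : ℕ} (a b c d : ZMod n) : Prop :=
  InOpenArc a b c ∧ InOpenArc b a d

/-- A triangulation of the `n`-gon (viewed combinatorially): a maximal set of pairwise non-crossing
chords. The chords are recorded as the edges of a graph on the vertices of the polygon;
they are the sides of the polygon and the diagonals of the triangulation. -/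
structure PolygonTriangulation (n : ℕ) where
  /-- The graph formed by the sides of the polygon and the diagonals of the triangulation. -/
  graph : SimpleGraph (ZMod n)
  side_adj : ∀ i : ZMod n, graph.Adj i (i + 1)
  noncrossing : ∀ a b c d : ZMod n, graph.Adj a b → graph.Adj c d → ¬ ChordsCross a b c d
  maximal : ∀ a b : ZMod n, a ≠ b →
    (∀ c d : ZMod n, graph.Adj c d → ¬ ChordsCross a b c d ∧ ¬ ChordsCross b a c d) →
    graph.Adj a b

namespace PolygonTriangulation

variable {n : ℕ} (T : PolygonTriangulation n)

/-- The triangular faces of `T`: triples of vertices, any two of which are joined by a side or by a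
diagonal of `T`. (The vertices are in convex position and the diagonals do not cross, so each
such triple bounds a face.) -/
abbrev Triangle : Type := {s : Finset (ZMod n) // T.graph.IsNClique 3 s}

/-- `a k`: the number of triangles of `T` incident with the vertex `k`. -/
noncomputable def a (k : ZMod n) : ℕ := Nat.card {w : T.Triangle // k ∈ w.1}

/-- The bipartite graph `G(T)`: the black vertices `Sum.inl v` are the vertices of `T`, the white
vertices `Sum.inr w` are the triangles of `T`, and the edges are the incidences. -/
def incidenceGraph : SimpleGraph (ZMod n ⊕ T.Triangle) where
  Adj x y := (∃ v w, v ∈ w.1 ∧ x = Sum.inl v ∧ y = Sum.inr w) ∨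
    (∃ v w, v ∈ w.1 ∧ x = Sum.inr w ∧ y = Sum.inl v)
  symm := ⟨by
    rintro x y (⟨v, w, h, hx, hy⟩ | ⟨v, w, h, hx, hy⟩)
    · exact Or.inr ⟨v, w, h, hy, hx⟩
    · exact Or.inl ⟨v, w, h, hy, hx⟩⟩
  loopless := ⟨by
    rintro x (⟨v, w, _, hx, hy⟩ | ⟨v, w, _, hx, hy⟩) <;> subst hx <;> cases hy⟩

/-- The graph `G_{i,j}`, obtained from `G(T)` by removing the black vertices `i` and `j` together
with all edges incident with them. -/
def deletedGraph (i j : ZMod n) :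
    SimpleGraph ↥(({Sum.inl i, Sum.inl j} : Set (ZMod n ⊕ T.Triangle))ᶜ) :=
  T.incidenceGraph.induce ({Sum.inl i, Sum.inl j} : Set (ZMod n ⊕ T.Triangle))ᶜ

/-- `m i j`: the number of perfect matchings of `G_{i,j}`. -/
noncomputable def m (i j : ZMod n) : ℕ :=
  Nat.card {M : (T.deletedGraph i j).Subgraph // M.IsPerfectMatching}

end PolygonTriangulation

/-- The array built by the frieze recurrence `D = (B * C - 1) / A` from a top row (row `1`) of ones
and from a second row with entries `a k`. An array `f` is indexed so that `f r i` is the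
entry of row `r` at horizontal position `i + r / 2`; thus `f (r + 1) i` is the entry directly below
`f (r - 1) (i + 1)`, and its upper left and upper right neighbours are `f r i` and `f r (i + 1)`.
The entry `a k` stands at horizontal position `k`, that is, it is `f 2 (k - 1)`.
Row `0` is only a placeholder. -/
def friezeRecurrence (a : ℤ → ℚ) : ℕ → ℤ → ℚ
  | 0, _ => 0
  | 1, _ => 1
  | 2, i => a (i + 1)
  | r + 3, i =>
      (friezeRecurrence a (r + 2) i * friezeRecurrence a (r + 2) (i + 1) - 1) /
        friezeRecurrence a (r + 1) (i + 1)

/-- The Conway-Coxeter array of the triangulation `T` of the `n`-gon, generated by the frieze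
recurrence from the numbers of triangles at the vertices. Its rows `1, …, n - 1` form the
Conway-Coxeter frieze pattern. -/
noncomputable def PolygonTriangulation.frieze {n : ℕ} (T : PolygonTriangulation n) :
    ℕ → ℤ → ℚ :=
  friezeRecurrence fun k => (T.a (k : ZMod n) : ℚ)

/-- The rows `1, …, n - 1` of `f` form a frieze pattern: every row has period `n`, the top and the
bottom row consist of ones, and every diamond centred in an intervening row satisfies
`A * D = B * C - 1`. -/
structure IsFriezePattern (n : ℕ) (f : ℕ → ℤ → ℚ) : Prop where
  periodic : ∀ r, 1 ≤ r → r < n → ∀ i : ℤ, f r (i + n) = f r i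
  top_row : ∀ i : ℤ, f 1 i = 1
  bottom_row : ∀ i : ℤ, f (n - 1) i = 1
  relation : ∀ r, 2 ≤ r → r + 2 ≤ n → ∀ i : ℤ,
    f (r - 1) (i + 1) * f (r + 1) i = f r i * f r (i + 1) - 1

/-! The matching numbers are 2 × 2 minors. Cut the polygon at a vertex `o`, so that its vertices are
linearly ordered and `o`, `o - 1` are the first and the last. Start from this side and glue on the
triangles of `T` one at a time, each along a boundary edge `ab` with a new apex `c`. Only the new
triangle contains `c`. If `c` is not deleted, it is therefore matched to that triangle and the old
number is unchanged. If `c` is deleted, the triangle takes `a` or `b`, so `m i c = m i a + m i b`,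
where a term is zero if its vertex is `i`. Giving `c` the sum of the vectors of `a` and `b`, as in
Farey addition, keeps `m i j = p i * q j - p j * q i` for `i` before `j` (`IsFareyPolygon.insert`).

The same induction shows that the numbers are positive, that they equal 1 for neighbours, and that
`m (k - 1) (k + 1)` counts the triangles at `k`. The diamond rule is then the Plücker relation for
`i, i + 1, i + r, i + r + 1`, with both neighbouring minors equal to 1 (`m_diamond`). Hence the
recurrence produces the `m i j` (`frieze_eq_m`), and the glide reflection is just `m i j = m j i`.
-/

/-! ### Counting systems of distinct representatives -/

/-- The number of ways to choose a system of distinct representatives of the sets in `W` whose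
set of representatives is `B`, as a coefficient of a product of linear forms. -/
noncomputable def matchCount {V : Type*} (B : Finset V) (W : Finset (Finset V)) : ℕ :=
  MvPolynomial.coeff (∑ x ∈ B, Finsupp.single x 1)
    (∏ w ∈ W, ∑ x ∈ w, (MvPolynomial.X x : MvPolynomial V ℕ))

theorem sum_single_apply {V : Type*} [DecidableEq V] (B : Finset V) (v : V) :
    (∑ x ∈ B, Finsupp.single x 1 : V →₀ ℕ) v = if v ∈ B then 1 else 0 := by
  simp [Finsupp.finsetSum_apply, Finsupp.single_apply]

theorem matchCount_empty {V : Type*} : matchCount (∅ : Finset V) ∅ = 1 := by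
  simp [matchCount]

/-- Expansion along one factor: choosing `X x` from the factor of `w` means that `x` represents `w`
and is used up. -/
theorem matchCount_insert {V : Type*} [DecidableEq V] (B : Finset V) {w : Finset V}
    {W : Finset (Finset V)} (hw : w ∉ W) :
    matchCount B (insert w W) = ∑ x ∈ w, if x ∈ B then matchCount (B.erase x) W else 0 := by
  unfold matchCount
  rw [Finset.prod_insert hw, Finset.sum_mul, MvPolynomial.coeff_sum]
  refine Finset.sum_congr rfl fun x _ => ?_
  have hmem : x ∈ (∑ x ∈ B, Finsupp.single x 1 : V →₀ ℕ).support ↔ x ∈ B := by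
    simp [Finsupp.mem_support_iff, sum_single_apply]
  rw [MvPolynomial.coeff_X_mul']
  by_cases hx : x ∈ B
  · rw [if_pos hx, if_pos (hmem.2 hx), ← Finset.sum_erase_add B _ hx, add_tsub_cancel_right]
  · rw [if_neg hx, if_neg (mt hmem.1 hx)]

theorem matchCount_eq_zero {V : Type*} [DecidableEq V] {B : Finset V} {W : Finset (Finset V)}
    {k : V} (hk : k ∈ B) (hW : ∀ w ∈ W, k ∉ w) : matchCount B W = 0 := by
  induction W using Finset.induction_on generalizing B with
  | empty =>
    have : (∑ x ∈ B, Finsupp.single x 1 : V →₀ ℕ) ≠ 0 := fun h => by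
      have := sum_single_apply B k
      simp [h, hk] at this
    rw [matchCount, Finset.prod_empty, MvPolynomial.coeff_one, if_neg this.symm]
  | insert w W hw ih =>
    rw [matchCount_insert B hw]
    refine Finset.sum_eq_zero fun x hx => ?_
    split_ifs
    · refine ih (Finset.mem_erase.2 ⟨?_, hk⟩) fun u hu => hW u (Finset.mem_insert_of_mem hu)
      rintro rfl
      exact hW w (Finset.mem_insert_self _ _) hx
    · rfl

/-- Multiplying out the product gives one monomial per choice function, so the coefficient counts
the choice functions whose monomial is the squarefree one of `B`. -/
theorem matchCount_eq_card {V : Type*} [DecidableEq V] (B : Finset V)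
    (W : Finset (Finset V)) {P : Finset V → Prop} (hP : ∀ w, w ∈ W ↔ P w) :
    matchCount B W = Nat.card {f : {w // P w} → V //
      (∀ w, f w ∈ w.1) ∧ f.Injective ∧ Set.range f = B} := by
  classical
  have : Fintype {w // P w} := Fintype.subtype W hP
  -- The exponent of `v` in the monomial of `f` is the size of the fibre of `f` over `v`; it must be
  -- 1 on `B` and 0 elsewhere.
  have h1 : ∀ f : {w // P w} → V, (∑ x ∈ B, Finsupp.single x 1 : V →₀ ℕ) =
      ∑ w, Finsupp.single (f w) 1 ↔ f.Injective ∧ Set.range f = B := by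
    intro f
    have h2 : ∀ v, (∑ w, Finsupp.single (f w) 1 : V →₀ ℕ) v =
        (Finset.univ.filter fun w => f w = v).card := by
      intro v
      simp [Finsupp.finsetSum_apply, Finsupp.single_apply]
    rw [Finsupp.ext_iff]
    simp only [h2, sum_single_apply]
    constructor
    · intro h
      refine ⟨fun x y hxy => ?_, Set.ext fun v => ⟨?_, fun hv => ?_⟩⟩
      · have h3 : (Finset.univ.filter fun w => f w = f y).card ≤ 1 := by
          rw [← h]; split_ifs <;> simp
        exact Finset.card_le_one.1 h3 x (by simpa using hxy) y (by simp)
      · rintro ⟨x, rfl⟩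
        by_contra hx
        have := h (f x)
        rw [if_neg (by simpa using hx), eq_comm, Finset.card_eq_zero] at this
        exact Finset.notMem_empty x (this ▸ by simp)
      · have := h v
        rw [if_pos (by simpa using hv)] at this
        obtain ⟨w, hw⟩ := Finset.card_pos.1 (this ▸ one_pos)
        exact ⟨w, by simpa using hw⟩
    · rintro ⟨hf, hB⟩ v
      split_ifs with hv
      · obtain ⟨w, rfl⟩ : v ∈ Set.range f := by rw [hB]; exact hv
        rw [eq_comm, Finset.card_eq_one]
        exact ⟨w, by ext u; simp [hf.eq_iff]⟩
      · rw [eq_comm, Finset.card_eq_zero, Finset.filter_eq_empty_iff]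
        rintro w - rfl
        exact hv (by rw [← Finset.mem_coe, ← hB]; exact ⟨w, rfl⟩)
  have h4 : (∏ w ∈ W, ∑ x ∈ w, (MvPolynomial.X x : MvPolynomial V ℕ)) =
      ∑ f ∈ Fintype.piFinset fun w : {w // P w} => w.1,
        MvPolynomial.monomial (∑ w, Finsupp.single (f w) 1) 1 := by
    rw [Finset.prod_subtype W hP, Finset.prod_univ_sum]
    refine Finset.sum_congr rfl fun f _ => ?_
    rw [MvPolynomial.monomial_sum_one]
    rfl
  rw [matchCount, h4, MvPolynomial.coeff_sum]
  simp only [MvPolynomial.coeff_monomial]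
  rw [← Finset.sum_filter, Finset.sum_const, smul_eq_mul, mul_one]
  symm
  refine Nat.subtype_card _ fun f => ?_
  rw [Finset.mem_filter, Fintype.mem_piFinset, eq_comm, h1]

/-! ### Ears and their effect on matching numbers -/

section
variable {V : Type*} [DecidableEq V]

theorem Finset.sum_triple {a b c : V} (hab : a ≠ b) (hac : a ≠ c) (hbc : b ≠ c) (f : V → ℕ) :
    ∑ x ∈ ({a, b, c} : Finset V), f x = f a + f b + f c := by
  rw [Finset.sum_insert (by simp [hab, hac]), Finset.sum_pair hbc, add_assoc]

variable [Fintype V]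

open Classical in
/-- The triangles of `G` with all vertices in `S`. -/
noncomputable def trianglesIn (G : SimpleGraph V) (S : Finset V) : Finset (Finset V) :=
  Finset.univ.filter fun w => G.IsNClique 3 w ∧ w ⊆ S

theorem mem_trianglesIn {G : SimpleGraph V} {S w : Finset V} :
    w ∈ trianglesIn G S ↔ G.IsNClique 3 w ∧ w ⊆ S := by
  simp [trianglesIn]

/-- The number of perfect matchings between `S \ {i, j}` and the triangles inside `S`. -/
noncomputable def matchCountIn (G : SimpleGraph V) (S : Finset V) (i j : V) : ℕ :=
  matchCount (S \ {i, j}) (trianglesIn G S)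

theorem matchCountIn_comm (G : SimpleGraph V) (S : Finset V) (i j : V) :
    matchCountIn G S i j = matchCountIn G S j i := by
  rw [matchCountIn, matchCountIn, Finset.pair_comm]

/-- `c` is a vertex outside `S` whose only neighbours in `S` are the adjacent vertices `a`, `b`. -/
structure IsEar (G : SimpleGraph V) (S : Finset V) (a b c : V) : Prop where
  left_mem : a ∈ S
  right_mem : b ∈ S
  notMem : c ∉ S
  adj : G.Adj a b
  adj_left : G.Adj a c
  adj_right : G.Adj b c
  eq_or_eq : ∀ x ∈ S, G.Adj x c → x = a ∨ x = b

namespace IsEar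
variable {G : SimpleGraph V} {S : Finset V} {a b c : V}

theorem notMem_trianglesIn (h : IsEar G S a b c) : {a, b, c} ∉ trianglesIn G S := fun hw =>
  h.notMem ((mem_trianglesIn.1 hw).2 (by simp))

theorem trianglesIn_insert (h : IsEar G S a b c) :
    trianglesIn G (insert c S) = insert {a, b, c} (trianglesIn G S) := by
  ext w
  rw [Finset.mem_insert, mem_trianglesIn, mem_trianglesIn]
  constructor
  · rintro ⟨hw, hS⟩
    by_cases hc : c ∈ w
    · left
      refine Finset.eq_of_subset_of_card_le (fun x hx => ?_) ?_
      · by_cases hxc : x = c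
        · simp [hxc]
        · have := h.eq_or_eq x (Finset.mem_of_mem_insert_of_ne (hS hx) hxc)
            (hw.isClique hx hc hxc)
          simp only [Finset.mem_insert]
          tauto
      · rw [hw.card_eq]
        exact Finset.card_le_three
    · exact Or.inr ⟨hw, fun x hx => Finset.mem_of_mem_insert_of_ne (hS hx)
        fun hxc => hc (hxc ▸ hx)⟩
  · rintro (rfl | ⟨hw, hS⟩)
    · refine ⟨SimpleGraph.is3Clique_triple_iff.2 ⟨h.adj, h.adj_left, h.adj_right⟩, ?_⟩
      intro x hx
      simp only [Finset.mem_insert, Finset.mem_singleton] at hx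
      rcases hx with rfl | rfl | rfl
      · exact Finset.mem_insert_of_mem h.left_mem
      · exact Finset.mem_insert_of_mem h.right_mem
      · exact Finset.mem_insert_self _ _
    · exact ⟨hw, hS.trans (Finset.subset_insert _ _)⟩

theorem notMem_of_mem_trianglesIn (h : IsEar G S a b c) :
    ∀ w ∈ trianglesIn G S, c ∉ w := fun _ hw hc =>
  h.notMem ((mem_trianglesIn.1 hw).2 hc)

theorem matchCountIn_insert (h : IsEar G S a b c) {i j : V} (hi : i ∈ S) (hj : j ∈ S) :
    matchCountIn G (insert c S) i j = matchCountIn G S i j := by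
  have hic : c ≠ i := fun e => h.notMem (e ▸ hi)
  have hjc : c ≠ j := fun e => h.notMem (e ▸ hj)
  -- If the ear triangle takes a vertex other than `c`, no triangle is left to cover `c`.
  have hz : ∀ x, c ≠ x →
      (if x ∈ insert c S \ {i, j} then matchCount ((insert c S \ {i, j}).erase x)
        (trianglesIn G S) else 0) = 0 := by
    intro x hx
    split_ifs
    · exact matchCount_eq_zero (k := c) (by simp [hx, hic, hjc]) h.notMem_of_mem_trianglesIn
    · rfl
  rw [matchCountIn, h.trianglesIn_insert, matchCount_insert _ h.notMem_trianglesIn, Finset.sum_triple h.adj.ne h.adj_left.ne h.adj_right.ne,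
    hz a h.adj_left.ne', hz b h.adj_right.ne', if_pos (by simp [hic, hjc]), zero_add, zero_add,
    matchCountIn]
  congr 1
  ext x
  simp only [Finset.mem_erase, Finset.mem_sdiff, Finset.mem_insert, Finset.mem_singleton]
  have := h.notMem
  constructor
  · tauto
  · rintro ⟨h1, h2⟩
    exact ⟨fun e => this (e ▸ h1), Or.inr h1, h2⟩

theorem matchCountIn_insert_right (h : IsEar G S a b c) (i : V) :
    matchCountIn G (insert c S) i c =
      (if a = i then 0 else matchCountIn G S i a) + (if b = i then 0 else matchCountIn G S i b) := by
  have hz : ∀ x ∈ S,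
      (if x ∈ insert c S \ {i, c} then matchCount ((insert c S \ {i, c}).erase x)
        (trianglesIn G S) else 0) = if x = i then 0 else matchCountIn G S i x := by
    intro x hx
    have hxc : x ≠ c := fun e => h.notMem (e ▸ hx)
    by_cases hxi : x = i
    · simp [hxi]
    · rw [if_neg hxi, if_pos (by simp [hxi, hxc, hx]), matchCountIn]
      congr 1
      ext y
      simp only [Finset.mem_erase, Finset.mem_sdiff, Finset.mem_insert, Finset.mem_singleton]
      have := h.notMem
      constructor
      · tauto
      · rintro ⟨h1, h2⟩
        have : y ≠ c := fun e => this (e ▸ h1)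
        tauto
  rw [matchCountIn, h.trianglesIn_insert, matchCount_insert _ h.notMem_trianglesIn, Finset.sum_triple h.adj.ne h.adj_left.ne h.adj_right.ne,
    hz a h.left_mem, hz b h.right_mem,
    if_neg (c := c ∈ insert c S \ {i, c}) (by simp), add_zero]

end IsEar

/-! ### Farey polygons, grown ear by ear -/

/-- `i` comes before `j` and no element of `S` lies strictly between them. -/
def IsGap (pos : V → ℕ) (S : Finset V) (i j : V) : Prop :=
  pos i < pos j ∧ ∀ x ∈ S, ¬ (pos i < pos x ∧ pos x < pos j)

/-- The number of triangles inside `S` at the vertex `k`. -/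
noncomputable def triangleDegree (G : SimpleGraph V) (S : Finset V) (k : V) : ℕ :=
  ((trianglesIn G S).filter (k ∈ ·)).card

theorem IsEar.triangleDegree_insert {G : SimpleGraph V} {S : Finset V} {a b c : V}
    (h : IsEar G S a b c) (k : V) :
    triangleDegree G (insert c S) k =
      triangleDegree G S k + if k = a ∨ k = b ∨ k = c then 1 else 0 := by
  rw [triangleDegree, h.trianglesIn_insert, Finset.filter_insert]
  have : k ∈ ({a, b, c} : Finset V) ↔ k = a ∨ k = b ∨ k = c := by simp
  by_cases hk : k = a ∨ k = b ∨ k = c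
  · rw [if_pos (this.2 hk), if_pos hk, Finset.card_insert_of_notMem, triangleDegree]
    exact fun hm => h.notMem_trianglesIn (Finset.mem_filter.1 hm).1
  · rw [if_neg (mt this.1 hk), if_neg hk, triangleDegree, add_zero]

theorem IsEar.triangleDegree_apex {G : SimpleGraph V} {S : Finset V} {a b c : V}
    (h : IsEar G S a b c) : triangleDegree G S c = 0 := by
  rw [triangleDegree, Finset.card_eq_zero, Finset.filter_eq_empty_iff]
  exact fun {w} hw => h.notMem_of_mem_trianglesIn w hw

/-- The sub-polygon with vertex set `S` is bounded by edges of `G`, and its matching numbers are the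
`2 × 2` minors of a matrix with rows `p` and `q`. -/
structure IsFareyPolygon (G : SimpleGraph V) (pos : V → ℕ) (S : Finset V) (p q : V → ℤ) :
    Prop where
  adj : ∀ i ∈ S, ∀ j ∈ S, IsGap pos S i j → G.Adj i j
  minor : ∀ i ∈ S, ∀ j ∈ S, pos i < pos j → (matchCountIn G S i j : ℤ) = p i * q j - p j * q i
  count_pos : ∀ i ∈ S, ∀ j ∈ S, pos i < pos j → 0 < matchCountIn G S i j
  one : ∀ i ∈ S, ∀ j ∈ S, IsGap pos S i j → matchCountIn G S i j = 1
  degree : ∀ i ∈ S, ∀ k ∈ S, ∀ j ∈ S, IsGap pos S i k → IsGap pos S k j →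
    matchCountIn G S i j = triangleDegree G S k

/-- Base case, a single edge without triangles: its ends get the vectors `(1, 0)` and `(0, 1)`, and
the empty matching gives the count 1. -/
theorem isFareyPolygon_pair {G : SimpleGraph V} {pos : V → ℕ} {lo hi : V} (hlt : pos lo < pos hi)
    (hadj : G.Adj lo hi) : IsFareyPolygon G pos {lo, hi} (fun x => if x = lo then 1 else 0)
      (fun x => if x = lo then 0 else 1) := by
  have key : ∀ i ∈ ({lo, hi} : Finset V), ∀ j ∈ ({lo, hi} : Finset V), pos i < pos j →
      i = lo ∧ j = hi := by
    intro i hi j hj hij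
    simp only [Finset.mem_insert, Finset.mem_singleton] at hi hj
    rcases hi with rfl | rfl <;> rcases hj with rfl | rfl <;> first | omega | simp
  have h1 : matchCountIn G {lo, hi} lo hi = 1 := by
    have : trianglesIn G {lo, hi} = ∅ := by
      refine Finset.eq_empty_of_forall_notMem fun w hw => ?_
      obtain ⟨h3, h4⟩ := mem_trianglesIn.1 hw
      have := (Finset.card_le_card h4).trans Finset.card_le_two
      rw [h3.card_eq] at this
      omega
    rw [matchCountIn, this, sdiff_self]
    exact matchCount_empty
  refine ⟨fun i hi j hj h => ?_, fun i hi j hj h => ?_, fun i hi j hj h => ?_,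
    fun i hi j hj h => ?_, fun i hi k hk j hj h h' => ?_⟩
  · obtain ⟨rfl, rfl⟩ := key i hi j hj h.1
    exact hadj
  · obtain ⟨rfl, rfl⟩ := key i hi j hj h
    simp [h1, hadj.ne']
  · obtain ⟨rfl, rfl⟩ := key i hi j hj h
    omega
  · obtain ⟨rfl, rfl⟩ := key i hi j hj h.1
    exact h1
  · obtain ⟨rfl, rfl⟩ := key i hi k hk h.1
    obtain ⟨e, -⟩ := key _ hk j hj h'.1
    exact absurd e hadj.ne'

/-- Both sides of the minor formula are additive at the apex. The vanishing minor of equal columns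
accounts for the term dropped when `i` is `a` or `b`. -/
theorem IsFareyPolygon.insert {G : SimpleGraph V} {pos : V → ℕ} (hpos : pos.Injective)
    {S : Finset V} {p q : V → ℤ} (hS : IsFareyPolygon G pos S p q) {a b c : V}
    (h : IsEar G S a b c) (hab : IsGap pos S a b) (hac : pos a < pos c) (hcb : pos c < pos b) :
    IsFareyPolygon G pos (insert c S) (Function.update p c (p a + p b))
      (Function.update q c (q a + q b)) := by
  have hne : ∀ {x}, x ∈ S → x ≠ c := fun hx e => h.notMem (e ▸ hx)
  have hle : ∀ {x}, x ∈ S → pos x < pos c → pos x ≤ pos a := fun {x} hx hxc => by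
    have := hab.2 x hx
    omega
  have hge : ∀ {x}, x ∈ S → pos c < pos x → pos b ≤ pos x := fun {x} hx hxc => by
    have := hab.2 x hx
    omega
  have gap_of : ∀ {i j}, IsGap pos (Insert.insert c S) i j → IsGap pos S i j := fun hg =>
    ⟨hg.1, fun x hx => hg.2 x (Finset.mem_insert_of_mem hx)⟩
  have gap_left : ∀ {i}, i ∈ S → IsGap pos (Insert.insert c S) i c → i = a := fun {i} hi hg => by
    have h1 := hg.2 a (Finset.mem_insert_of_mem h.left_mem)
    have h2 := hle hi hg.1
    exact hpos (by omega)
  have gap_right : ∀ {j}, j ∈ S → IsGap pos (Insert.insert c S) c j → j = b := fun {j} hj hg => by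
    have h1 := hg.2 b (Finset.mem_insert_of_mem h.right_mem)
    have h2 := hge hj hg.1
    exact hpos (by omega)
  have hone := hS.one a h.left_mem b h.right_mem hab
  have cnt_left : matchCountIn G (Insert.insert c S) a c = 1 := by
    rw [h.matchCountIn_insert_right, if_pos rfl, if_neg h.adj.ne', hone]
  have cnt_right : matchCountIn G (Insert.insert c S) c b = 1 := by
    rw [matchCountIn_comm, h.matchCountIn_insert_right, if_neg h.adj.ne, if_pos rfl,
      matchCountIn_comm, hone]
  refine ⟨fun i hi j hj hg => ?_, fun i hi j hj hij => ?_, fun i hi j hj hij => ?_,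
    fun i hi j hj hg => ?_, fun i hi k hk j hj h1 h2 => ?_⟩
  · rw [Finset.mem_insert] at hi hj
    rcases hi with rfl | hi <;> rcases hj with rfl | hj
    · exact absurd hg.1 (lt_irrefl _)
    · rw [gap_right hj hg]; exact h.adj_right.symm
    · rw [gap_left hi hg]; exact h.adj_left
    · exact hS.adj i hi j hj (gap_of hg)
  · rw [Finset.mem_insert] at hi hj
    rcases hi with rfl | hi <;> rcases hj with rfl | hj
    · exact absurd hij (lt_irrefl _)
    · rw [matchCountIn_comm, h.matchCountIn_insert_right, if_neg (by rintro rfl; omega)]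
      simp only [Function.update_self, Function.update_of_ne (hne hj)]
      have hbj := hge hj hij
      have h3 := hS.minor a h.left_mem j hj (by omega)
      rw [matchCountIn_comm G S j a, matchCountIn_comm G S j b]
      split_ifs with e
      · subst e
        push_cast
        rw [h3]; ring
      · have h4 := hS.minor b h.right_mem j hj (lt_of_le_of_ne hbj fun e' => e (hpos e'))
        push_cast
        rw [h3, h4]; ring
    · rw [h.matchCountIn_insert_right, if_neg (c := b = i) (by rintro rfl; omega)]
      simp only [Function.update_self, Function.update_of_ne (hne hi)]
      have hia := hle hi hij
      have h3 := hS.minor i hi b h.right_mem (by omega)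
      split_ifs with e
      · subst e
        push_cast
        rw [h3]; ring
      · have h4 := hS.minor i hi a h.left_mem (lt_of_le_of_ne hia fun e' => e (hpos e'.symm))
        push_cast
        rw [h3, h4]; ring
    · rw [h.matchCountIn_insert hi hj, Function.update_of_ne (hne hi),
        Function.update_of_ne (hne hi), Function.update_of_ne (hne hj),
        Function.update_of_ne (hne hj)]
      exact hS.minor i hi j hj hij
  · rw [Finset.mem_insert] at hi hj
    rcases hi with rfl | hi <;> rcases hj with rfl | hj
    · exact absurd hij (lt_irrefl _)
    · rw [matchCountIn_comm, h.matchCountIn_insert_right, if_neg (by rintro rfl; omega),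
        matchCountIn_comm]
      have hbj := hge hj hij
      have := hS.count_pos a h.left_mem j hj (by omega)
      omega
    · rw [h.matchCountIn_insert_right, if_neg (c := b = i) (by rintro rfl; omega)]
      have hia := hle hi hij
      have := hS.count_pos i hi b h.right_mem (by omega)
      omega
    · rw [h.matchCountIn_insert hi hj]
      exact hS.count_pos i hi j hj hij
  · rw [Finset.mem_insert] at hi hj
    rcases hi with rfl | hi <;> rcases hj with rfl | hj
    · exact absurd hg.1 (lt_irrefl _)
    · rw [gap_right hj hg, cnt_right]
    · rw [gap_left hi hg, cnt_left]
    · rw [h.matchCountIn_insert hi hj]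
      exact hS.one i hi j hj (gap_of hg)
  · rw [h.triangleDegree_insert]
    rw [Finset.mem_insert] at hk
    -- The degree changes only at `a`, `b`, `c`. At `c` both sides are 1; at `a` or `b` the additive
    -- rule adds a neighbour count, which is 1, to the old degree.
    rcases hk with rfl | hk
    · have hi := Finset.mem_of_mem_insert_of_ne hi (by rintro rfl; exact lt_irrefl _ h1.1)
      have hj := Finset.mem_of_mem_insert_of_ne hj (by rintro rfl; exact lt_irrefl _ h2.1)
      obtain rfl := gap_left hi h1
      obtain rfl := gap_right hj h2
      rw [h.matchCountIn_insert hi hj, hone, h.triangleDegree_apex]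
      simp
    · rw [Finset.mem_insert] at hi
      rcases hi with rfl | hi
      · obtain rfl := gap_right hk h1
        have hj := Finset.mem_of_mem_insert_of_ne hj
          (by rintro rfl; have := h1.1; have := h2.1; omega)
        have hkj := h2.1
        rw [matchCountIn_comm, h.matchCountIn_insert_right, if_neg (by rintro rfl; omega),
          if_neg (by rintro rfl; omega), if_pos (by simp), matchCountIn_comm G S j a,
          matchCountIn_comm G S j k, hS.one k hk j hj (gap_of h2),
          hS.degree a h.left_mem k hk j hj hab (gap_of h2)]
      · rw [Finset.mem_insert] at hj
        rcases hj with rfl | hj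
        · obtain rfl := gap_left hk h2
          have hki := h1.1
          rw [h.matchCountIn_insert_right, if_neg (by rintro rfl; omega),
            if_neg (by rintro rfl; omega), if_pos (by simp), hS.one i hi k hk (gap_of h1),
            hS.degree i hi k hk b h.right_mem (gap_of h1) hab, add_comm]
        · have ha : k ≠ a := by
            rintro rfl
            have h3 := h2.2 c (Finset.mem_insert_self _ _)
            have h4 := hab.2 j hj
            have h5 := h2.1
            have : pos j ≠ pos c := fun e => hne hj (hpos e)
            omega
          have hb : k ≠ b := by
            rintro rfl
            have h3 := h1.2 c (Finset.mem_insert_self _ _)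
            have h4 := hab.2 i hi
            have h5 := h1.1
            have : pos i ≠ pos c := fun e => hne hi (hpos e)
            omega
          rw [h.matchCountIn_insert hi hj, if_neg (by simp [ha, hb, hne hk]), add_zero]
          exact hS.degree i hi k hk j hj (gap_of h1) (gap_of h2)

/-- In a graph on linearly placed vertices which has no crossing edges, joins the first vertex to
the last one and has a triangle below each edge that spans some vertex, the matching numbers are
those of a Farey polygon. -/
theorem exists_isFareyPolygon_univ {G : SimpleGraph V} {pos : V → ℕ} (hpos : pos.Injective)
    {lo hi : V} (hlt : pos lo < pos hi) (hadj : G.Adj lo hi) (hlo : ∀ x, pos lo ≤ pos x)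
    (hhi : ∀ x, pos x ≤ pos hi)
    (hcross : ∀ x y z w, pos x < pos y → pos y < pos z → pos z < pos w →
      G.Adj x z → ¬ G.Adj y w)
    (hapex : ∀ a b x, pos a < pos x → pos x < pos b → G.Adj a b →
      ∃ c, pos a < pos c ∧ pos c < pos b ∧ G.Adj a c ∧ G.Adj b c) :
    ∃ p q, IsFareyPolygon G pos Finset.univ p q := by
  have key : ∀ d (S : Finset V) p q, d + S.card = Fintype.card V → lo ∈ S → hi ∈ S →
      IsFareyPolygon G pos S p q → ∃ p q, IsFareyPolygon G pos Finset.univ p q := by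
    intro d
    induction d with
    | zero =>
      intro S p q hd _ _ hS
      rw [(Finset.card_eq_iff_eq_univ S).1 (by omega)] at hS
      exact ⟨p, q, hS⟩
    | succ d ih =>
      intro S p q hd hloS hhiS hS
      obtain ⟨x, hx⟩ : ∃ x, x ∉ S := by
        by_contra! hall
        rw [(Finset.card_eq_iff_eq_univ S).2 (Finset.eq_univ_of_forall hall)] at hd
        omega
      have hxne : ∀ y ∈ S, pos y ≠ pos x := fun y hy e => hx (hpos e ▸ hy)
      obtain ⟨a, ha, hamax⟩ := (S.filter (pos · < pos x)).exists_max_image pos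
        ⟨lo, Finset.mem_filter.2 ⟨hloS, lt_of_le_of_ne (hlo x) (hxne lo hloS)⟩⟩
      obtain ⟨b, hb, hbmin⟩ := (S.filter (pos x < pos ·)).exists_min_image pos
        ⟨hi, Finset.mem_filter.2 ⟨hhiS, lt_of_le_of_ne (hhi x) (hxne hi hhiS).symm⟩⟩
      rw [Finset.mem_filter] at ha hb
      have hab : IsGap pos S a b := by
        refine ⟨ha.2.trans hb.2, fun y hy hlt' => ?_⟩
        rcases lt_or_gt_of_ne (hxne y hy) with h1 | h1
        · have := hamax y (Finset.mem_filter.2 ⟨hy, h1⟩)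
          omega
        · have := hbmin y (Finset.mem_filter.2 ⟨hy, h1⟩)
          omega
      have habadj := hS.adj a ha.1 b hb.1 hab
      -- The apex `c` need not be `x`; the missing vertex only shows that the edge `ab` spans
      -- something.
      obtain ⟨c, hac, hcb, hac', hbc'⟩ := hapex a b x ha.2 hb.2 habadj
      have hc : c ∉ S := fun hc => hab.2 c hc ⟨hac, hcb⟩
      -- An edge from `c` to any other vertex of `S` would cross `ab`.
      have hear : IsEar G S a b c := by
        refine ⟨ha.1, hb.1, hc, habadj, hac', hbc', fun y hy hyc => ?_⟩
        rcases lt_trichotomy (pos y) (pos a) with h1 | h1 | h1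
        · exact absurd habadj (hcross y a c b h1 hac hcb hyc)
        · exact Or.inl (hpos h1)
        · rcases lt_trichotomy (pos y) (pos b) with h2 | h2 | h2
          · exact absurd ⟨h1, h2⟩ (hab.2 y hy)
          · exact Or.inr (hpos h2)
          · exact absurd hyc.symm (hcross a c b y hac hcb h2 habadj)
      refine ih (Insert.insert c S) _ _ ?_ (Finset.mem_insert_of_mem hloS)
        (Finset.mem_insert_of_mem hhiS) (hS.insert hpos hear hab hac hcb)
      rw [Finset.card_insert_of_notMem hc]
      omega
  refine key (Fintype.card V - ({lo, hi} : Finset V).card) {lo, hi} _ _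
    (Nat.sub_add_cancel (Finset.card_le_univ _)) (by simp) (by simp)
    (isFareyPolygon_pair hlt hadj)

end

/-! ### Cutting the circle at a base point -/

theorem ZMod.val_sub_eq_ite {n : ℕ} [NeZero n] (u v : ZMod n) :
    (u - v).val = if v.val ≤ u.val then u.val - v.val else u.val + n - v.val := by
  split_ifs with h
  · exact ZMod.val_sub h
  · have hv := v.val_lt
    have : u - v = ((u.val + n - v.val : ℕ) : ZMod n) := by
      rw [Nat.cast_sub (by omega)]
      simp
    rw [this, ZMod.val_natCast_of_lt (by omega)]

theorem inOpenArc_iff {n : ℕ} [NeZero n] (o : ZMod n) {a b : ZMod n}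
    (hab : (a - o).val < (b - o).val) (x : ZMod n) :
    InOpenArc a b x ↔ (a - o).val < (x - o).val ∧ (x - o).val < (b - o).val := by
  have h1 := ZMod.val_sub_eq_ite (x - o) (a - o)
  have h2 := ZMod.val_sub_eq_ite (b - o) (a - o)
  rw [sub_sub_sub_cancel_right] at h1 h2
  have := (a - o).val_lt
  have := (b - o).val_lt
  rw [InOpenArc, h1, h2]
  split_ifs <;> omega

theorem inOpenArc_iff_of_gt {n : ℕ} [NeZero n] (o : ZMod n) {a b : ZMod n}
    (hab : (a - o).val < (b - o).val) (x : ZMod n) :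
    InOpenArc b a x ↔ (x - o).val < (a - o).val ∨ (b - o).val < (x - o).val := by
  have h1 := ZMod.val_sub_eq_ite (x - o) (b - o)
  have h2 := ZMod.val_sub_eq_ite (a - o) (b - o)
  rw [sub_sub_sub_cancel_right] at h1 h2
  have := (a - o).val_lt
  have := (b - o).val_lt
  have := (x - o).val_lt
  rw [InOpenArc, h1, h2]
  split_ifs <;> omega

theorem chordsCross_iff {n : ℕ} [NeZero n] (o : ZMod n) {a b : ZMod n}
    (hab : (a - o).val < (b - o).val) (c d : ZMod n) :
    ChordsCross a b c d ↔ ((a - o).val < (c - o).val ∧ (c - o).val < (b - o).val) ∧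
      ((d - o).val < (a - o).val ∨ (b - o).val < (d - o).val) := by
  rw [ChordsCross, inOpenArc_iff o hab, inOpenArc_iff_of_gt o hab]

/-! ### Triangulations are Farey polygons -/

namespace PolygonTriangulation

variable {n : ℕ} (T : PolygonTriangulation n)

/-- Take for `c` the last neighbour of `a` strictly before `b`. No edge crosses `cb`, so maximality
makes `cb` an edge. -/
theorem exists_apex [NeZero n] (o : ZMod n) {a b x : ZMod n} (hax : (a - o).val < (x - o).val)
    (hxb : (x - o).val < (b - o).val) (hab : T.graph.Adj a b) :
    ∃ c, (a - o).val < (c - o).val ∧ (c - o).val < (b - o).val ∧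
      T.graph.Adj a c ∧ T.graph.Adj b c := by
  classical
  have hb := (b - o).val_lt
  have hn : Fact (1 < n) := ⟨by omega⟩
  have hsucc : (a + 1 - o).val = (a - o).val + 1 := by
    rw [add_sub_right_comm, ZMod.val_add_of_lt] <;> rw [ZMod.val_one]
    omega
  obtain ⟨c, hc, hmax⟩ := (Finset.univ.filter fun c => T.graph.Adj a c ∧
    (a - o).val < (c - o).val ∧ (c - o).val < (b - o).val).exists_max_image (fun c => (c - o).val)
    ⟨a + 1, by simp only [Finset.mem_filter, Finset.mem_univ, true_and]
               exact ⟨T.side_adj a, by omega, by omega⟩⟩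
  simp only [Finset.mem_filter, Finset.mem_univ, true_and] at hc hmax
  obtain ⟨hadj, hac, hcb⟩ := hc
  refine ⟨c, hac, hcb, hadj, (T.maximal c b (by rintro rfl; omega) ?_).symm⟩
  have key : ∀ y z, T.graph.Adj y z → ¬ ChordsCross c b y z := by
    intro y z hyz hcr
    rw [chordsCross_iff o hcb] at hcr
    have h1 := T.noncrossing a b y z hab hyz
    have h2 := T.noncrossing a c z y hadj hyz.symm
    rw [chordsCross_iff o (by omega)] at h1 h2
    -- An edge crossing `cb` starts at some `y` between `c` and `b`. It cannot cross `ab` or `ac`,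
    -- so it ends at `a`, which makes `y` a later neighbour of `a` than `c`.
    have h3 : (z - o).val = (a - o).val := by omega
    have h4 : z = a := by simpa using ZMod.val_injective n h3
    have := hmax y ⟨h4 ▸ hyz.symm, by omega, by omega⟩
    omega
  exact fun y z hyz => ⟨key y z hyz, fun h => key z y hyz.symm ⟨h.2, h.1⟩⟩

theorem exists_isFareyPolygon (hn : 2 ≤ n) [NeZero n] (o : ZMod n) :
    ∃ p q, IsFareyPolygon T.graph (fun x => (x - o).val) Finset.univ p q := by
  have hlast : (o - 1 - o).val = n - 1 := by
    obtain ⟨k, rfl⟩ : ∃ k, n = k + 1 := ⟨n - 1, by omega⟩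
    rw [sub_sub_cancel_left, ZMod.val_neg_one]
    rfl
  refine exists_isFareyPolygon_univ (lo := o) (hi := o - 1) (fun x y h => ?_) ?_ ?_ (fun x => ?_)
    (fun x => ?_) (fun x y z w h1 h2 h3 hxz hyw => ?_) fun a b x h1 h2 h => T.exists_apex o h1 h2 h
  · simpa using ZMod.val_injective n h
  · simp only [hlast, sub_self, ZMod.val_zero]
    omega
  · simpa using (T.side_adj (o - 1)).symm
  · simp
  · have := (x - o).val_lt
    simp only [hlast]
    omega
  · refine T.noncrossing x z y w hxz hyw ((chordsCross_iff o ?_ y w).2 ?_)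
    · exact h1.trans h2
    · exact ⟨⟨h1, h2⟩, Or.inr h3⟩

/-! ### Perfect matchings as choice functions -/

/-- The subgraph of `G_{i,j}` that joins each triangle to its image under `f`. -/
def matchingOfFun (i j : ZMod n) (f : T.Triangle → ZMod n) (hf : ∀ w, f w ∈ w.1) :
    (T.deletedGraph i j).Subgraph where
  verts := Set.univ
  Adj x y := (∃ w, x.1 = Sum.inr w ∧ y.1 = Sum.inl (f w)) ∨
    (∃ w, y.1 = Sum.inr w ∧ x.1 = Sum.inl (f w))
  adj_sub := by
    rintro x y (⟨w, hx, hy⟩ | ⟨w, hy, hx⟩)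
    · exact Or.inr ⟨f w, w, hf w, hx, hy⟩
    · exact Or.inl ⟨f w, w, hf w, hx, hy⟩
  edge_vert _ := trivial
  symm := ⟨fun _ _ h => h.symm⟩

theorem incidenceGraph_adj_inr {w : T.Triangle} {y : ZMod n ⊕ T.Triangle}
    (h : T.incidenceGraph.Adj (Sum.inr w) y) : ∃ v ∈ w.1, y = Sum.inl v := by
  rcases h with ⟨v, w', hv, hx, hy⟩ | ⟨v, w', hv, hx, hy⟩
  · cases hx
  · cases hx
    exact ⟨v, hv, hy⟩

theorem incidenceGraph_adj_inl {v : ZMod n} {y : ZMod n ⊕ T.Triangle}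
    (h : T.incidenceGraph.Adj (Sum.inl v) y) : ∃ w : T.Triangle, y = Sum.inr w := by
  rcases h with ⟨v, w', hv, hx, hy⟩ | ⟨v, w', hv, hx, hy⟩
  · exact ⟨w', hy⟩
  · cases hx

theorem isPerfectMatching_matchingOfFun {i j : ZMod n} {f : T.Triangle → ZMod n}
    (hf : ∀ w, f w ∈ w.1) (hinj : f.Injective) (hrange : Set.range f = {i, j}ᶜ) :
    (T.matchingOfFun i j f hf).IsPerfectMatching := by
  refine ⟨?_, fun _ => trivial⟩
  rintro ⟨x | w, hx⟩ -
  · have : x ∈ Set.range f := by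
      rw [hrange]
      simpa using hx
    obtain ⟨w, rfl⟩ := this
    refine ⟨⟨Sum.inr w, by simp⟩, Or.inr ⟨w, rfl, rfl⟩, ?_⟩
    rintro y (⟨w', h1, h2⟩ | ⟨w', h1, h2⟩)
    · cases h1
    · exact Subtype.ext (h1.trans (congrArg Sum.inr (hinj (Sum.inl.inj h2)).symm))
  · have : f w ∈ ({i, j} : Set (ZMod n))ᶜ := hrange ▸ ⟨w, rfl⟩
    refine ⟨⟨Sum.inl (f w), by simpa using this⟩, Or.inl ⟨w, rfl, rfl⟩, ?_⟩
    rintro y (⟨w', h1, h2⟩ | ⟨w', h1, h2⟩)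
    · cases h1
      exact Subtype.ext h2
    · cases h2

theorem exists_eq_matchingOfFun {i j : ZMod n} {M : (T.deletedGraph i j).Subgraph}
    (hM : M.IsPerfectMatching) : ∃ (f : T.Triangle → ZMod n) (hf : ∀ w, f w ∈ w.1),
      f.Injective ∧ Set.range f = {i, j}ᶜ ∧ T.matchingOfFun i j f hf = M := by
  have h1 : ∀ w : T.Triangle, ∃ v, v ∈ w.1 ∧ ∃ hv, M.Adj ⟨Sum.inr w, by simp⟩ ⟨Sum.inl v, hv⟩ := by
    intro w
    obtain ⟨⟨y, hy⟩, hwy, -⟩ := hM.1 (hM.2 ⟨Sum.inr w, by simp⟩)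
    obtain ⟨v, hv, rfl⟩ := T.incidenceGraph_adj_inr (M.adj_sub hwy)
    exact ⟨v, hv, hy, hwy⟩
  choose f hf hfm hadj using h1
  have hw : ∀ {w y}, M.Adj ⟨Sum.inr w, by simp⟩ y ↔ y.1 = Sum.inl (f w) := by
    intro w y
    constructor
    · intro h
      exact congrArg Subtype.val (hM.1.eq_of_adj_left h (hadj w))
    · intro h
      obtain rfl : y = ⟨Sum.inl (f w), hfm w⟩ := Subtype.ext h
      exact hadj w
  have hinj : f.Injective := by
    intro w w' h
    have h2 := hM.1.eq_of_adj_right (hadj w) (hw.2 (congrArg Sum.inl h))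
    simpa using h2
  refine ⟨f, hf, hinj, ?_, ?_⟩
  · ext v
    constructor
    · rintro ⟨w, rfl⟩
      simpa using hfm w
    · intro hv
      obtain ⟨⟨y, hy⟩, hvy, -⟩ := hM.1 (hM.2 ⟨Sum.inl v, by simpa using hv⟩)
      obtain ⟨w, rfl⟩ := T.incidenceGraph_adj_inl (M.adj_sub hvy)
      exact ⟨w, (Sum.inl.inj (hw.1 hvy.symm)).symm⟩
  · refine SimpleGraph.Subgraph.ext ?_ ?_
    · exact (Set.eq_univ_of_forall hM.2).symm
    · ext ⟨x, hx⟩ ⟨y, hy⟩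
      constructor
      · rintro (⟨w, rfl, h⟩ | ⟨w, rfl, h⟩)
        · exact hw.2 h
        · exact (hw.2 h).symm
      · intro h
        rcases x with v | w
        · obtain ⟨w, rfl⟩ := T.incidenceGraph_adj_inl (M.adj_sub h)
          exact Or.inr ⟨w, rfl, hw.1 h.symm⟩
        · exact Or.inl ⟨w, rfl, hw.1 h⟩

/-- A perfect matching is determined by the vertex it assigns to each triangle. Disjointness of its
edges is injectivity, and covering the black vertices fixes the range. -/
theorem m_eq_card_fun (i j : ZMod n) : T.m i j = Nat.card {f : T.Triangle → ZMod n //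
    (∀ w, f w ∈ w.1) ∧ f.Injective ∧ Set.range f = {i, j}ᶜ} := by
  symm
  refine Nat.card_congr (Equiv.ofBijective (fun f => ⟨T.matchingOfFun i j f.1 f.2.1,
    T.isPerfectMatching_matchingOfFun f.2.1 f.2.2.1 f.2.2.2⟩) ⟨?_, ?_⟩)
  · rintro ⟨f, hf, hinj, hrange⟩ ⟨g, hg, _, _⟩ h
    refine Subtype.ext (funext fun w => ?_)
    have hm : f w ∈ ({i, j} : Set (ZMod n))ᶜ := hrange ▸ ⟨w, rfl⟩
    have h1 : (T.matchingOfFun i j f hf).Adj ⟨Sum.inr w, by simp⟩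
        ⟨Sum.inl (f w), by simpa using hm⟩ := Or.inl ⟨w, rfl, rfl⟩
    rw [show T.matchingOfFun i j f hf = T.matchingOfFun i j g hg from congrArg Subtype.val h] at h1
    rcases h1 with ⟨w', h1, h2⟩ | ⟨w', h1, h2⟩
    · cases h1
      exact Sum.inl.inj h2
    · cases h1
  · rintro ⟨M, hM⟩
    obtain ⟨f, hf, hinj, hrange, rfl⟩ := T.exists_eq_matchingOfFun hM
    exact ⟨⟨f, hf, hinj, hrange⟩, rfl⟩

theorem m_eq_matchCountIn [NeZero n] (i j : ZMod n) :
    T.m i j = matchCountIn T.graph Finset.univ i j := by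
  rw [m_eq_card_fun, matchCountIn, matchCount_eq_card _ _ (P := fun w => T.graph.IsNClique 3 w)
    (by simp [mem_trianglesIn])]
  simp [Set.compl_eq_univ_sdiff]

theorem a_eq_triangleDegree [NeZero n] (k : ZMod n) :
    T.a k = triangleDegree T.graph Finset.univ k := by
  exact (Nat.card_congr (Equiv.subtypeSubtypeEquivSubtypeInter _ (k ∈ ·))).trans
    (Nat.subtype_card _ fun w => by simp [mem_trianglesIn])

end PolygonTriangulation

/-! ### The frieze pattern -/

namespace PolygonTriangulation

variable {n : ℕ} (T : PolygonTriangulation n)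

theorem m_comm (i j : ZMod n) : T.m i j = T.m j i := by
  rw [m_eq_card_fun, m_eq_card_fun, Set.pair_comm]

theorem m_pos (hn : 2 ≤ n) {i j : ZMod n} (hij : i ≠ j) : 0 < T.m i j := by
  have : NeZero n := ⟨by omega⟩
  obtain ⟨p, q, h⟩ := T.exists_isFareyPolygon hn i
  rw [m_eq_matchCountIn]
  refine h.count_pos i (Finset.mem_univ _) j (Finset.mem_univ _) ?_
  rw [sub_self, ZMod.val_zero, Nat.pos_iff_ne_zero, Ne, ZMod.val_eq_zero, sub_eq_zero]
  exact hij.symm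

theorem val_add_natCast_sub [NeZero n] (i : ZMod n) {r : ℕ} (hr : r < n) :
    (i + r - i).val = r := by
  rw [add_sub_cancel_left, ZMod.val_natCast_of_lt hr]

theorem isGap_succ [NeZero n] (i : ZMod n) {r : ℕ} (hr : r + 1 < n) :
    IsGap (fun x => (x - i).val) Finset.univ (i + r) (i + (r + 1 : ℕ)) := by
  have h1 := val_add_natCast_sub i (r := r) (by omega)
  have h2 := val_add_natCast_sub i hr
  refine ⟨?_, fun x _ => ?_⟩
  · simp only [h1, h2]
    omega
  · simp only [h1, h2]
    omega

theorem m_succ (hn : 2 ≤ n) (i : ZMod n) : T.m i (i + 1) = 1 := by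
  have : NeZero n := ⟨by omega⟩
  obtain ⟨p, q, h⟩ := T.exists_isFareyPolygon hn i
  have := h.one _ (Finset.mem_univ _) _ (Finset.mem_univ _) (isGap_succ i (r := 0) (by omega))
  rw [m_eq_matchCountIn]
  simpa using this

theorem m_add_two (hn : 3 ≤ n) (i : ZMod n) : T.m i (i + 2) = T.a (i + 1) := by
  have : NeZero n := ⟨by omega⟩
  obtain ⟨p, q, h⟩ := T.exists_isFareyPolygon (by omega) i
  have := h.degree _ (Finset.mem_univ _) _ (Finset.mem_univ _) _ (Finset.mem_univ _)
    (isGap_succ i (r := 0) (by omega)) (isGap_succ i (r := 1) (by omega))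
  rw [m_eq_matchCountIn, a_eq_triangleDegree]
  simpa using this

/-- The diamond relation of the matching numbers. -/
theorem m_diamond (i : ZMod n) {r : ℕ} (hr : 2 ≤ r) (hrn : r + 1 < n) :
    (T.m (i + 1) (i + r) * T.m i (i + (r + 1 : ℕ)) : ℤ) =
      T.m i (i + r) * T.m (i + 1) (i + (r + 1 : ℕ)) - 1 := by
  have : NeZero n := ⟨by omega⟩
  -- Cutting at `i` puts the four vertices in linear order, since `r + 1 < n`.
  obtain ⟨p, q, h⟩ := T.exists_isFareyPolygon (by omega) i
  have key : ∀ s t : ℕ, s < t → t < n → (T.m (i + s) (i + t) : ℤ) =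
      p (i + s) * q (i + t) - p (i + t) * q (i + s) := by
    intro s t hst htn
    rw [m_eq_matchCountIn, h.minor _ (Finset.mem_univ _) _ (Finset.mem_univ _)]
    simpa only [val_add_natCast_sub i (hst.trans htn), val_add_natCast_sub i htn] using hst
  have h01 := key 0 1 (by omega) (by omega)
  have h0r := key 0 r (by omega) (by omega)
  have h0s := key 0 (r + 1) (by omega) (by omega)
  have h1r := key 1 r (by omega) (by omega)
  have h1s := key 1 (r + 1) (by omega) (by omega)
  have hrs := key r (r + 1) (by omega) (by omega)
  have e1 := T.m_succ (by omega) i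
  have e2 := T.m_succ (by omega) (i + r)
  rw [add_assoc, ← Nat.cast_succ] at e2
  simp only [Nat.cast_zero, Nat.cast_one, add_zero] at h01 h0r h0s h1r h1s
  rw [e1] at h01
  rw [e2] at hrs
  rw [h0r, h0s, h1r, h1s]
  push_cast at *
  -- The Plücker relation, with the minors of `i, i + 1` and of `i + r, i + r + 1` replaced by 1.
  linear_combination h01 + (p i * q (i + 1) - p (i + 1) * q i) * hrs

theorem intCast_ne_intCast_add {n r : ℕ} (hr : 1 ≤ r) (hrn : r < n) (i : ℤ) :
    (i : ZMod n) ≠ ((i + r : ℤ) : ZMod n) := by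
  rw [Int.cast_add, Ne, left_eq_add, Int.cast_natCast, ZMod.natCast_eq_zero_iff]
  exact fun h => by have := Nat.le_of_dvd (by omega) h; omega

/-- Both arrays have the same first two rows and satisfy the diamond rule; positivity of `m` allows
the division. -/
theorem frieze_eq_m (hn : 3 ≤ n) {r : ℕ} (hr : 1 ≤ r) (hrn : r < n) (i : ℤ) :
    T.frieze r i = (T.m (i : ZMod n) ((i + r : ℤ) : ZMod n) : ℚ) := by
  induction r using Nat.strong_induction_on generalizing i with
  | _ r ih =>
    match r, hr with
    | 1, _ =>
      simp [frieze, friezeRecurrence, m_succ T (by omega : 2 ≤ n)]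
    | 2, _ =>
      simp [frieze, friezeRecurrence, m_add_two T hn]
    | r + 3, _ =>
      have hrec : T.frieze (r + 3) i = (T.frieze (r + 2) i * T.frieze (r + 2) (i + 1) - 1) /
        T.frieze (r + 1) (i + 1) := rfl
      rw [hrec, ih (r + 2) (by omega) (by omega) (by omega),
        ih (r + 2) (by omega) (by omega) (by omega), ih (r + 1) (by omega) (by omega) (by omega)]
      have hpos := T.m_pos (by omega)
        (intCast_ne_intCast_add (n := n) (r := r + 1) (by omega) (by omega) (i + 1))
      rw [div_eq_iff (by positivity)]
      have hd := T.m_diamond (i : ZMod n) (r := r + 2) (by omega) (by omega)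
      rw [show r + 2 + 1 = r + 3 from rfl] at hd
      have c1 : ((i + 1 + (r + 1 : ℕ) : ℤ) : ZMod n) = i + (r + 2 : ℕ) := by push_cast; ring
      have c2 : ((i + 1 + (r + 2 : ℕ) : ℤ) : ZMod n) = i + (r + 3 : ℕ) := by push_cast; ring
      rw [c1, c2, Int.cast_add i 1, Int.cast_one, Int.cast_add i, Int.cast_add i,
        Int.cast_natCast, Int.cast_natCast]
      have hd' := congrArg (Int.cast : ℤ → ℚ) hd
      push_cast at hd' ⊢
      linear_combination -hd'

theorem frieze_ne_zero (hn : 3 ≤ n) {r : ℕ} (hr : 1 ≤ r) (hrn : r < n) (i : ℤ) :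
    T.frieze r i ≠ 0 := by
  rw [T.frieze_eq_m hn hr hrn]
  exact_mod_cast (T.m_pos (by omega) (intCast_ne_intCast_add hr hrn i)).ne'

theorem frieze_glide (hn : 3 ≤ n) {r : ℕ} (hr : 1 ≤ r) (hrn : r < n) (i : ℤ) :
    T.frieze (n - r) (i + r) = T.frieze r i := by
  rw [T.frieze_eq_m hn hr hrn, T.frieze_eq_m hn (by omega) (by omega), m_comm]
  congr 2
  rw [Nat.cast_sub hrn.le]
  push_cast
  simp

theorem isFriezePattern_frieze (hn : 3 ≤ n) : IsFriezePattern n T.frieze where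
  periodic r hr hrn i := by
    rw [T.frieze_eq_m hn hr hrn, T.frieze_eq_m hn hr hrn]
    push_cast
    simp
  top_row _ := rfl
  -- The bottom row is the glide image of the top row.
  bottom_row i := by
    have := T.frieze_glide hn (r := 1) le_rfl (by omega) (i - 1)
    rw [Nat.cast_one, sub_add_cancel] at this
    exact this
  relation r hr hrn i := by
    obtain ⟨s, rfl⟩ : ∃ s, r = s + 2 := ⟨r - 2, by omega⟩
    exact mul_div_cancel₀ _ (T.frieze_ne_zero hn (r := s + 1) (by omega) (by omega) (i + 1))

end PolygonTriangulation

theorem theorem1 (n : ℕ) (hn : 3 ≤ n) (T : PolygonTriangulation n) :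
    -- the recurrence never divides by zero
    (∀ r : ℕ, 1 ≤ r → r + 3 ≤ n → ∀ i : ℤ, T.frieze r i ≠ 0) ∧
    -- the array it produces is a frieze pattern
    IsFriezePattern n T.frieze ∧
    -- and it is the array of the matching numbers
    (∀ r : ℕ, 1 ≤ r → r < n → ∀ i : ℤ,
      T.frieze r i = (T.m (i : ZMod n) ((i + r : ℤ) : ZMod n) : ℚ)) ∧
    -- which are positive
    (∀ i j : ZMod n, i ≠ j → 0 < T.m i j) ∧
    -- glide-reflection symmetry: row `n - r` is row `r` shifted by `n / 2` positions
    (∀ r : ℕ, 1 ≤ r → r < n → ∀ i : ℤ, T.frieze (n - r) (i + r) = T.frieze r i) :=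
  ⟨fun _ hr hrn i => T.frieze_ne_zero hn hr (by omega) i, T.isFriezePattern_frieze hn,
    fun _ hr hrn i => T.frieze_eq_m hn hr hrn i, fun _ _ hij => T.m_pos (by omega) hij,
    fun _ hr hrn i => T.frieze_glide hn hr hrn i⟩
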